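/- **Setting.** A stream is a sequence of finite segments $\mathcal D_1,\mathcal D_2,\dots$ of records $x$, with an oracle predicate $\mathcal O(x)\in\{0,1\}$ and a statistic $f(x)\in\mathbb R$. Each segment is divided into $K$ strata $\mathcal D_{t1},\dots,\mathcal D_{tK}$ by a stratification that does not depend on which records are sampled (for instance one computed from proxy scores). For a finite set $S$ of records put $S^+=\{x\in S:\mathcal O(x)=1\}$. Let $p_{tk}=|\mathcal D_{tk}^+|/|\mathcal D_{tk}|$, $w_{tk}=|\mathcal D_{tk}|/|\mathcal D_t|$, let $\sigma_{tk}$ be the standard deviation of $f$ on $\mathcal D_{tk}^+$, and let $\mu_t$ be the mean of $f$ over $\mathcal D_t^+$. Quotients $0/0$ and means over the empty set are $0$. **Algorithm (InQuest with $\alpha=0$, defensive budget $N_1\ge1$, dynamic budget $N_2\ge1$, $N=N_1+N_2$).** In the pilot segment $t=1$ it draws $N$ records of $\mathcal D_1$ uniformly without replacement (all records if there are fewer), and $X_{1k}$ is the set of drawn records in stratum $k$. In each segment $t\ge2$, given the earlier samples, it draws, independently for $k=1,\dots,K$, a uniformly random subset $X_{tk}\subseteq\mathcal D_{tk}$ of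 size $\min(\lfloor N_1/K+N_2\,\bar a_{tk}\rfloor,|\mathcal D_{tk}|)$, where $$\bar a_{tk}=\frac1{t-1}\sum_{s<t}a_{sk},\qquad a_{sk}=\frac{\sqrt{\hat p_{sk}}\,w_{sk}\,\hat\sigma_{sk}}{\sum_{j}\sqrt{\hat p_{sj}}\,w_{sj}\,\hat\sigma_{sj}},\qquad \hat p_{sk}=\frac{|X_{sk}^+|}{|X_{sk}|},$$ and $\hat\mu_{sk}$, $\hat\sigma_{sk}^2$ are the sample mean and the sample variance (denominator $|X_{sk}^+|-1$; $0$ if $|X_{sk}^+|\le1$) of $f$ on $X_{sk}^+$. Its estimate of $\mu_t$ is $$\hat\mu_t=\sum_{k=1}^K\hat\mu_{tk}\,\frac{\hat p_{tk}|\mathcal D_{tk}|}{\sum_{j}\hat p_{tj}|\mathcal D_{tj}|}.$$ **Theorem 2 (InQuest error convergence).** Let $K$, $p,w,\sigma\in\mathbb R^K$ and $c>0$ be given, with $p_k\ne0$ for at least one $k$ and $\sigma_k\neq0$ whenever $p_k\ne0$. There is a constant $C>0$, depending only on $K,p,w,\sigma,c$, such that the following holds for every stream that is stationary with these parameters ($p_{tk}=p_k$,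 $w_{tk}=w_k$, $\sigma_{tk}=\sigma_k$ for all $t,k$) and sub-Gaussian with constant $c$ (the mean of $\exp(f(x)^2/c^2)$ over $x\in\mathcal D_{tk}^+$ is at most $2$ for all $t,k$), for all $N_1,N_2\ge1$ and all $t\ge1$. Put $$r=\frac1{N_1}+\frac{N_1}{N_2^2}+\frac1{N_2\sqrt{N_1}}+\frac1{N_2\sqrt{N_1t}} .$$ Then $\mathbb E[(\hat\mu_t-\mu_t)^2]\le C\,r$. Moreover, for every $\delta\in(0,1]$ and every sub-$\sigma$-algebra $\mathcal G$ of the $\sigma$-algebra of the samples in segments $1,\dots,t$, with probability at least $1-\delta$ over these samples, $$\mathbb E[(\hat\mu_t-\mu_t)^2\mid\mathcal G]\le\frac C\delta\,r .$$ If $N_1=N_2$, both bounds hold with $r$ replaced by $1/N$. -/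

import Mathlib

open MeasureTheory

namespace InQuest

/-- Arithmetic mean of `g` over a finite set of records (`0` on the empty set). -/
noncomputable def avg {ρ : Type*} (S : Finset ρ) (g : ρ → ℝ) : ℝ :=
  (∑ x ∈ S, g x) / (S.card : ℝ)

/-- A stream of records, processed in finite segments, with the oracle predicate, the statistic to
be averaged and a division of every segment into `K` strata. Segments are numbered from `0`, and
segment `0` is the pilot segment. The stratification is arbitrary, but it does not depend on which
records get sampled (as is the case if it is computed from the proxy scores of the records). -/
structure Stream (ρ : Type*) (K : ℕ) where
  /-- the records of segment `t` -/
  segment : ℕ → Finset ρ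
  /-- the stratum of a record of segment `t` -/
  stratum : ℕ → ρ → Fin K
  /-- the oracle predicate -/
  oracle : ρ → Bool
  /-- the statistic -/
  f : ρ → ℝ

namespace Stream

variable {ρ : Type*} {K : ℕ} (D : Stream ρ K)

/-- The members of `S` that satisfy the oracle predicate. -/
def pos (S : Finset ρ) : Finset ρ := S.filter fun x => D.oracle x = true

/-- The records of segment `t` in stratum `k`. -/
def cell (t : ℕ) (k : Fin K) : Finset ρ := (D.segment t).filter fun x => D.stratum t x = k

/-- True predicate positive rate of a stratum. -/
noncomputable def posRate (t : ℕ) (k : Fin K) : ℝ :=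
  ((D.pos (D.cell t k)).card : ℝ) / ((D.cell t k).card : ℝ)

/-- Fraction of the records of the segment that fall in a stratum. -/
noncomputable def frac (t : ℕ) (k : Fin K) : ℝ :=
  ((D.cell t k).card : ℝ) / ((D.segment t).card : ℝ)

/-- True standard deviation of the statistic on the predicate matching records of a stratum. -/
noncomputable def std (t : ℕ) (k : Fin K) : ℝ :=
  √(avg (D.pos (D.cell t k)) fun x => (D.f x - avg (D.pos (D.cell t k)) D.f) ^ 2)

/-- The segment mean: the mean of the statistic over the predicate matching records. -/
noncomputable def mean (t : ℕ) : ℝ := avg (D.pos (D.segment t)) D.f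

/-- Predicate positive rates, stratum fractions and standard deviations do not change with time. -/
structure Stationary (p w σ : Fin K → ℝ) : Prop where
  posRate_eq : ∀ t k, D.posRate t k = p k
  frac_eq : ∀ t k, D.frac t k = w k
  std_eq : ∀ t k, D.std t k = σ k

/-- A predicate matching record, drawn uniformly from any stratum of any segment, has a
sub-Gaussian statistic with constant `c`, that is `𝔼 exp (X² / c²) ≤ 2`. -/
def SubGaussian (c : ℝ) : Prop :=
  ∀ t k, avg (D.pos (D.cell t k)) (fun x => Real.exp (D.f x ^ 2 / c ^ 2)) ≤ 2

/-! ### Estimates computed from a sample -/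

/-- Sample predicate positive rate. -/
noncomputable def pHat (S : Finset ρ) : ℝ := ((D.pos S).card : ℝ) / (S.card : ℝ)

/-- Sample mean of the statistic over predicate matching samples (`0` if there are none). -/
noncomputable def muHat (S : Finset ρ) : ℝ := avg (D.pos S) D.f

/-- Sample variance over predicate matching samples (`0` if there are fewer than two). -/
noncomputable def varHat (S : Finset ρ) : ℝ :=
  if 1 < (D.pos S).card then
    (∑ x ∈ D.pos S, (D.f x - D.muHat S) ^ 2) / (((D.pos S).card : ℝ) - 1)
  else 0

/-- The allocation computed from the samples `X k` of the strata of segment `t`; it is zero if all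
the estimated standard deviations vanish. -/
noncomputable def rawAlloc (t : ℕ) (X : Fin K → Finset ρ) (k : Fin K) : ℝ :=
  (√(D.pHat (X k)) * D.frac t k * √(D.varHat (X k))) /
    ∑ j, √(D.pHat (X j)) * D.frac t j * √(D.varHat (X j))

/-- The estimate of the mean of segment `t` from the samples `X k` of its strata. -/
noncomputable def estimate (t : ℕ) (X : Fin K → Finset ρ) : ℝ :=
  ∑ k, D.muHat (X k) *
    (D.pHat (X k) * ((D.cell t k).card : ℝ) / ∑ j, D.pHat (X j) * ((D.cell t j).card : ℝ))

end Stream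

/-- Exponentially weighted moving average with smoothing parameter `α` (for `α = 0` it is the
unweighted mean). -/
noncomputable def ewma (α : ℝ) (t : ℕ) (a : Fin t → ℝ) : ℝ :=
  (∑ s : Fin t, (1 - α) ^ (t - 1 - (s : ℕ)) * a s) / ∑ s : Fin t, (1 - α) ^ (t - 1 - (s : ℕ))

/-- The samples drawn in the first `t` segments, by segment and stratum. -/
def History (ρ : Type*) (K t : ℕ) : Type _ := Fin t → Fin K → Finset ρ

instance (ρ : Type*) (K t : ℕ) : MeasurableSpace (History ρ K t) := ⊤

namespace Stream

variable {ρ : Type*} {K : ℕ} (D : Stream ρ K)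

/-- The fraction of the budget `N₁ + N₂` that stratum `k` gets in the segment that follows the
history `h`. -/
noncomputable def alloc (α : ℝ) (N₁ N₂ : ℕ) {t : ℕ} (h : History ρ K t) (k : Fin K) : ℝ :=
  ((N₁ : ℝ) / K + N₂ * ewma α t fun s => D.rawAlloc s (h s) k) / ((N₁ : ℝ) + N₂)

/-- Number of records sampled from stratum `k` of segment `t`, after the history `h`: the budget,
rounded down, or all the records if there are fewer. -/
noncomputable def sampleSize (α : ℝ) (N₁ N₂ : ℕ) {t : ℕ} (h : History ρ K t) (k : Fin K) : ℕ :=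
  min ⌊((N₁ : ℝ) + N₂) * D.alloc α N₁ N₂ h k⌋₊ (D.cell t k).card

/-- The pilot sample: `N` records of segment `0` (or all of them, if there are fewer), uniformly
without replacement, sorted by stratum. -/
noncomputable def pilotLaw (N : ℕ) : PMF (Fin K → Finset ρ) :=
  (PMF.uniformOfFinset ((D.segment 0).powersetCard (min N (D.segment 0).card))
    (Finset.powersetCard_nonempty.2 (min_le_right _ _))).map
    fun S k => S.filter fun x => D.stratum 0 x = k

/-- Stratified reservoir sampling in the segment after the history `h`: independently for each
stratum `k`, a uniformly random subset of the stratum of the allocated size. -/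
noncomputable def reservoirLaw (α : ℝ) (N₁ N₂ : ℕ) {t : ℕ} (h : History ρ K t) :
    PMF (Fin K → Finset ρ) :=
  PMF.uniformOfFinset
    (Fintype.piFinset fun k => (D.cell t k).powersetCard (D.sampleSize α N₁ N₂ h k))
    (Fintype.piFinset_nonempty.2 fun _ => Finset.powersetCard_nonempty.2 (min_le_right _ _))

/-- Law of the samples of segment `t` given the samples of the segments before it. -/
noncomputable def segmentLaw (α : ℝ) (N₁ N₂ : ℕ) :
    (t : ℕ) → History ρ K t → PMF (Fin K → Finset ρ)
  | 0, _ => D.pilotLaw (N₁ + N₂)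
  | _ + 1, h => D.reservoirLaw α N₁ N₂ h

/-- Joint law of the samples that the algorithm draws in the first `t` segments. -/
noncomputable def historyLaw (α : ℝ) (N₁ N₂ : ℕ) : (t : ℕ) → PMF (History ρ K t)
  | 0 => PMF.pure Fin.elim0
  | t + 1 => (historyLaw α N₁ N₂ t).bind fun h =>
      (D.segmentLaw α N₁ N₂ t h).map fun X => (Fin.snoc h X : Fin (t + 1) → Fin K → Finset ρ)

/-- Squared error of the estimate of the mean of segment `t`. -/
noncomputable def sqError (t : ℕ) (h : History ρ K (t + 1)) : ℝ :=
  (D.estimate t (h (Fin.last t)) - D.mean t) ^ 2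

end Stream

/-- The expectation of `Z` is at most `C * r`; moreover, for every `δ`, whatever part `𝒢` of the
information in the samples one conditions on, with probability at least `1 - δ` over the samples the
conditional expectation of `Z` given `𝒢` is at most `C / δ * r`. -/
def ExpectationLE {Ω : Type*} [mΩ : MeasurableSpace Ω] (P : Measure Ω) (Z : Ω → ℝ)
    (C r : ℝ) : Prop :=
  Integrable Z P ∧ ∫ ω, Z ω ∂P ≤ C * r ∧
    ∀ δ : ℝ, 0 < δ → δ ≤ 1 → ∀ 𝒢 : MeasurableSpace Ω, 𝒢 ≤ mΩ →
      1 - δ ≤ P.real {ω | (P[Z | 𝒢]) ω ≤ C / δ * r}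

end InQuest

/-! The term `1 / N₁` of the rate already dominates the error, so it is enough to bound the mean
squared error by a constant over `N₁`, conditionally on every history. Of the adaptive allocation
only its nonnegativity matters: the defensive budget alone forces the sample size plus one to be at
least `N₁ / K` in every stratum that is not exhausted (`samplingError_reservoir_le`). In the pilot
segment a Chebyshev argument for the number of draws per stratum replaces it
(`avg_samplingError_pilot_le`).

Given the history, the estimate minus the segment mean is a ratio. Its numerator is a weighted sum
of stratum sample means with population value `0`; its denominator `B` has population value `b`, the
fraction of positive records. Sampling without replacement has nonpositive covariances, so both have
variance of order one over the sample size (`sum_sq_avg_le`). If `B ≥ b / 2`, the numerator controls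
the error. Otherwise the squared error is at most a sum of sample second moments, and the factor `4
* (B - b) ^ 2 / b ^ 2 ≥ 1` may be inserted. That factor depends on the sample rates only, and given
these the positive samples are still uniform, so the expectation of the product splits
(`Exchangeable.sum_pHat_mul_avg_le`). Hence second moments of the statistic suffice.

The bounds with probability `1 - δ` are Markov's inequality for the conditional expectation, whose
mean is the unconditional error. -/

namespace InQuest

open Finset

open scoped ENNReal

/-! ### Averages -/

section avg

variable {ρ : Type*} (S : Finset ρ) (g h : ρ → ℝ)

lemma avg_nonneg (hg : ∀ x ∈ S, 0 ≤ g x) : 0 ≤ avg S g :=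
  div_nonneg (sum_nonneg hg) (Nat.cast_nonneg _)

lemma card_mul_avg : (S.card : ℝ) * avg S g = ∑ x ∈ S, g x := by
  rcases S.eq_empty_or_nonempty with rfl | hS
  · simp [avg]
  · have : (S.card : ℝ) ≠ 0 := by exact_mod_cast hS.card_pos.ne'
    rw [avg]; field_simp

lemma avg_mono (hgh : ∀ x ∈ S, g x ≤ h x) : avg S g ≤ avg S h :=
  div_le_div_of_nonneg_right (sum_le_sum hgh) (Nat.cast_nonneg _)

lemma avg_add : avg S (fun x => g x + h x) = avg S g + avg S h := by
  simp only [avg, sum_add_distrib, add_div]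

lemma avg_const_mul (a : ℝ) : avg S (fun x => a * g x) = a * avg S g := by
  simp only [avg, ← mul_sum, mul_div_assoc]

lemma avg_const {S : Finset ρ} (hS : S.Nonempty) (a : ℝ) : avg S (fun _ => a) = a := by
  have : (S.card : ℝ) ≠ 0 := by exact_mod_cast hS.card_pos.ne'
  simp [avg]; field_simp

lemma avg_const_le {a : ℝ} (ha : 0 ≤ a) : avg S (fun _ => a) ≤ a := by
  rcases S.eq_empty_or_nonempty with rfl | hS
  · simpa [avg]
  · rw [avg_const hS]

lemma avg_sub_const {S : Finset ρ} (hS : S.Nonempty) (a : ℝ) :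
    avg S (fun x => g x - a) = avg S g - a := by
  have := avg_add S g (fun _ => -a)
  rw [avg_const hS] at this
  simpa only [sub_eq_add_neg] using this

lemma sq_avg_le : avg S g ^ 2 ≤ avg S fun x => g x ^ 2 := by
  rcases S.eq_empty_or_nonempty with rfl | hS
  · simp [avg]
  · have : 0 < (S.card : ℝ) := by exact_mod_cast hS.card_pos
    rw [avg, avg, div_pow, div_le_div_iff₀ (by positivity) this]
    nlinarith [sq_sum_le_card_mul_sum_sq (s := S) (f := g)]

/-- The mean square deviation from the mean is at most the mean square. -/
lemma avg_sq_sub_avg_le : avg S (fun x => (g x - avg S g) ^ 2) ≤ avg S fun x => g x ^ 2 := by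
  rcases S.eq_empty_or_nonempty with rfl | hS
  · simp [avg]
  · have h1 : avg S (fun x => (g x - avg S g) ^ 2)
        = avg S (fun x => g x ^ 2) + (avg S (fun x => (-2 * avg S g) * g x)
          + avg S fun _ => avg S g ^ 2) := by
      rw [← avg_add, ← avg_add]
      congr 1; ext x; ring
    rw [h1, avg_const_mul, avg_const hS]
    nlinarith [sq_nonneg (avg S g)]

end avg

/-! ### Random subsets whose law is invariant under transpositions -/

section sampling

variable {ι ρ : Type*} [DecidableEq ρ]

/-- If the weighted law of a random subset of `T` treats the members of `T` alike, then the expected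
sample mean of a nonnegative function is at most its mean over `T`. -/
lemma sum_mul_avg_le {U : Finset ι} {S : ι → Finset ρ} {T : Finset ρ} {φ : ι → ℝ} {q : ρ → ℝ}
    (hST : ∀ u ∈ U, S u ⊆ T) (hφ : ∀ u ∈ U, 0 ≤ φ u) (hq : ∀ x ∈ T, 0 ≤ q x)
    (hsymm : ∀ x ∈ T, ∀ y ∈ T, ∑ u ∈ U, (if x ∈ S u then φ u / (S u).card else 0)
      = ∑ u ∈ U, if y ∈ S u then φ u / (S u).card else 0) :
    ∑ u ∈ U, φ u * avg (S u) q ≤ (∑ u ∈ U, φ u) * avg T q := by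
  set M : ρ → ℝ := fun x => ∑ u ∈ U, if x ∈ S u then φ u / (S u).card else 0 with hM
  have expand : ∀ g : ρ → ℝ, ∑ u ∈ U, φ u * avg (S u) g = ∑ x ∈ T, g x * M x := by
    intro g
    simp only [hM, mul_sum]
    rw [sum_comm]
    refine sum_congr rfl fun u hu => ?_
    rw [avg, ← mul_div_assoc, mul_sum, sum_div]
    simp only [mul_ite, mul_zero]
    rw [← sum_filter, filter_mem_eq_inter, inter_eq_right.2 (hST u hu)]
    exact sum_congr rfl fun x _ => by ring
  rcases T.eq_empty_or_nonempty with rfl | ⟨x₀, hx₀⟩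
  · rw [expand]; simp [avg]
  · have hc : ∀ x ∈ T, M x = M x₀ := fun x hx => hsymm x hx x₀ hx₀
    -- Testing the expansion on the constant `1` determines the common weight. Only an inequality
    -- results, because an empty sample has average `0`.
    have h1 : (T.card : ℝ) * M x₀ ≤ ∑ u ∈ U, φ u := by
      have := expand fun _ => 1
      simp only [one_mul] at this
      rw [sum_congr rfl hc, sum_const, nsmul_eq_mul] at this
      rw [← this]
      refine sum_le_sum fun u hu => ?_
      exact mul_le_of_le_one_right (hφ u hu) (avg_const_le _ zero_le_one)
    rw [expand, sum_congr rfl fun x hx => by rw [hc x hx], ← sum_mul, ← card_mul_avg]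
    nlinarith [avg_nonneg T q hq]

/-- The variance of a sample mean, for sampling without replacement. -/
lemma sum_sq_avg_le {U : Finset ι} {S : ι → Finset ρ} {T : Finset ρ} {φ : ℕ → ℝ} {h : ρ → ℝ}
    (hST : ∀ u ∈ U, S u ⊆ T) (hφ : ∀ n, 0 ≤ φ n) (hh : ∑ x ∈ T, h x = 0)
    (hswap : ∀ x ∈ T, ∀ y ∈ T, ∀ G : Finset ρ → ℝ,
      ∑ u ∈ U, G (S u) = ∑ u ∈ U, G ((S u).map (Equiv.swap x y).toEmbedding)) :
    ∑ u ∈ U, φ (S u).card * avg (S u) h ^ 2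
      ≤ (∑ u ∈ U, φ (S u).card / (S u).card) * avg T fun x => h x ^ 2 := by
  set c : ι → ℝ := fun u => φ (S u).card / (S u).card ^ 2 with hc
  have hc0 : ∀ u, 0 ≤ c u := fun u => div_nonneg (hφ _) (by positivity)
  set M : ρ → ρ → ℝ := fun x y => ∑ u ∈ U, if x ∈ S u ∧ y ∈ S u then c u else 0 with hM
  have hM0 : ∀ x y, 0 ≤ M x y := fun x y => sum_nonneg fun u _ => by
    split_ifs
    · exact hc0 u
    · exact le_rfl
  have hMswap : ∀ x ∈ T, ∀ y ∈ T, ∀ a b, M a b = M (Equiv.swap x y a) (Equiv.swap x y b) := by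
    intro x hx y hy a b
    refine (hswap x hx y hy
      fun A => if a ∈ A ∧ b ∈ A then φ A.card / A.card ^ 2 else 0).trans ?_
    simp only [hM, hc, mem_map_equiv, card_map, Equiv.symm_swap]
  have expand : ∑ u ∈ U, φ (S u).card * avg (S u) h ^ 2
      = ∑ x ∈ T, h x * ∑ y ∈ T, h y * M x y := by
    have h1 : ∀ u ∈ U, φ (S u).card * avg (S u) h ^ 2
        = ∑ x ∈ T, ∑ y ∈ T, h x * (h y * if x ∈ S u ∧ y ∈ S u then c u else 0) := by
      intro u hu
      have h2 : ∑ x ∈ S u, h x = ∑ x ∈ T, if x ∈ S u then h x else 0 := by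
        rw [← sum_filter, filter_mem_eq_inter, inter_eq_right.2 (hST u hu)]
      have h3 : φ (S u).card * avg (S u) h ^ 2
          = c u * ((∑ x ∈ S u, h x) * ∑ x ∈ S u, h x) := by
        simp only [avg, hc]; ring
      rw [h3, h2, sum_mul_sum, mul_sum]
      refine sum_congr rfl fun x _ => ?_
      rw [mul_sum]
      refine sum_congr rfl fun y _ => ?_
      by_cases hx : x ∈ S u <;> by_cases hy : y ∈ S u <;> simp [hx, hy]
      ring
    rw [sum_congr rfl h1, sum_comm]
    refine sum_congr rfl fun x _ => ?_
    rw [sum_comm, mul_sum]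
    refine sum_congr rfl fun y _ => ?_
    simp only [hM, mul_sum]
  -- By symmetry the joint inclusion weight of `x` and `y ≠ x` is a constant `b ≥ 0`. As `h` sums to
  -- zero, the off-diagonal terms of row `x` add up to `-b * h x ^ 2 ≤ 0`, and only the diagonal
  -- remains.
  have inner_le : ∀ x ∈ T, h x * ∑ y ∈ T, h y * M x y ≤ h x ^ 2 * M x x := by
    intro x hx
    obtain ⟨b, hb0, hb⟩ : ∃ b, 0 ≤ b ∧ ∀ y ∈ T.erase x, M x y = b := by
      rcases (T.erase x).eq_empty_or_nonempty with he | ⟨z, hz⟩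
      · exact ⟨0, le_rfl, by simp [he]⟩
      · refine ⟨M x z, hM0 _ _, fun y hy => ?_⟩
        rw [hMswap y (mem_of_mem_erase hy) z (mem_of_mem_erase hz) x y, Equiv.swap_apply_left,
          Equiv.swap_apply_of_ne_of_ne (ne_of_mem_erase hy).symm (ne_of_mem_erase hz).symm]
    have h1 : ∑ y ∈ T.erase x, h y = -h x := by
      have := add_sum_erase T h hx
      linarith
    rw [← add_sum_erase T _ hx, sum_congr rfl fun y hy => by rw [hb y hy], ← sum_mul, h1]
    nlinarith [mul_nonneg (sq_nonneg (h x)) hb0]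
  rw [expand]
  refine (sum_le_sum inner_le).trans ?_
  rcases T.eq_empty_or_nonempty with rfl | ⟨x₀, hx₀⟩
  · simp [avg]
  · have hd : ∀ x ∈ T, M x x = M x₀ x₀ := fun x hx => by
      rw [hMswap x hx x₀ hx₀, Equiv.swap_apply_left]
    have htot : (T.card : ℝ) * M x₀ x₀ = ∑ u ∈ U, φ (S u).card / (S u).card := by
      rw [← nsmul_eq_mul, ← sum_const, ← sum_congr rfl hd]
      simp only [hM, and_self]
      rw [sum_comm]
      refine sum_congr rfl fun u hu => ?_
      rw [← sum_filter, filter_mem_eq_inter, inter_eq_right.2 (hST u hu), sum_const, nsmul_eq_mul]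
      simp only [hc]
      rcases eq_or_ne ((S u).card : ℝ) 0 with h0 | h0
      · simp [h0]
      · field_simp
    rw [sum_congr rfl fun x hx => by rw [hd x hx], ← sum_mul, ← htot,
      ← card_mul_avg T fun x => h x ^ 2]
    exact le_of_eq (by ring)

lemma sum_powersetCard_swap {T : Finset ρ} (n : ℕ) {x y : ρ} (hx : x ∈ T) (hy : y ∈ T)
    (G : Finset ρ → ℝ) :
    ∑ S ∈ T.powersetCard n, G S
      = ∑ S ∈ T.powersetCard n, G (S.map (Equiv.swap x y).toEmbedding) := by
  have hinv : ∀ S : Finset ρ,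
      (S.map (Equiv.swap x y).toEmbedding).map (Equiv.swap x y).toEmbedding = S := by
    intro S; ext z; simp [mem_map_equiv]
  have hT : ∀ z ∈ T, Equiv.swap x y z ∈ T := by
    intro z hz
    rw [Equiv.swap_apply_def]
    split_ifs <;> assumption
  have hmem : ∀ S ∈ T.powersetCard n, S.map (Equiv.swap x y).toEmbedding ∈ T.powersetCard n := by
    intro S hS
    rw [mem_powersetCard] at hS ⊢
    refine ⟨fun z hz => ?_, by rw [card_map, hS.2]⟩
    rw [mem_map_equiv, Equiv.symm_swap] at hz
    simpa using hT _ (hS.1 hz)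
  exact sum_nbij' (fun S => S.map (Equiv.swap x y).toEmbedding)
    (fun S => S.map (Equiv.swap x y).toEmbedding) hmem hmem (fun S _ => hinv S)
    (fun S _ => hinv S) fun S _ => by rw [hinv]

end sampling

/-! ### Expectations -/

section expectation

/-- The support of a `PMF` is countable, so the integral is a sum even on an uncountable space and
`g` may be arbitrary. -/
lemma lintegral_toMeasure {α : Type*} [MeasurableSpace α] [MeasurableSingletonClass α]
    (P : PMF α) (g : α → ℝ≥0∞) : ∫⁻ a, g a ∂P.toMeasure = ∑' a, P a * g a := by
  rw [← PMF.restrict_toMeasure_support P, lintegral_countable g P.support_countable]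
  rw [← tsum_subtype_eq_of_support_subset (s := P.support)]
  · refine tsum_congr fun a => ?_
    rw [PMF.toMeasure_apply_singleton _ _ (measurableSet_singleton _), mul_comm]
  · intro a ha
    rw [PMF.mem_support_iff]
    exact left_ne_zero_of_mul ha

lemma tsum_bind_mul {α β : Type*} (P : PMF α) (Q : α → PMF β) (g : β → ℝ≥0∞) :
    ∑' b, P.bind Q b * g b = ∑' a, P a * ∑' b, Q a b * g b := by
  simp only [PMF.bind_apply, ← ENNReal.tsum_mul_right, ← ENNReal.tsum_mul_left]
  rw [ENNReal.tsum_comm]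
  simp only [mul_assoc]

lemma tsum_map_mul {α β : Type*} (P : PMF α) (φ : α → β) (g : β → ℝ≥0∞) :
    ∑' b, P.map φ b * g b = ∑' a, P a * g (φ a) := by
  rw [PMF.map, tsum_bind_mul]
  refine tsum_congr fun a => ?_
  rw [tsum_eq_single (φ a)]
  · simp
  · intro b hb; simp [hb]

lemma tsum_uniformOfFinset_mul {α : Type*} (U : Finset α) (hU : U.Nonempty) {g : α → ℝ}
    (hg : ∀ a, 0 ≤ g a) :
    ∑' a, PMF.uniformOfFinset U hU a * ENNReal.ofReal (g a) = ENNReal.ofReal (avg U g) := by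
  rw [tsum_eq_sum (s := U) fun a ha => by simp [ha]]
  rw [sum_congr rfl fun a ha => by rw [PMF.uniformOfFinset_apply_of_mem hU ha], ← mul_sum,
    ← ENNReal.ofReal_sum_of_nonneg fun a _ => hg a, avg,
    ENNReal.ofReal_div_of_pos (by exact_mod_cast hU.card_pos), ENNReal.ofReal_natCast, mul_comm,
    div_eq_mul_inv]

/-- Markov's inequality for the conditional expectations of a nonnegative random variable. -/
lemma expectationLE_of_lintegral_le {Ω : Type*} [mΩ : MeasurableSpace Ω] (P : Measure Ω)
    [IsProbabilityMeasure P] {Z : Ω → ℝ} (hZm : Measurable Z) (hZ : ∀ ω, 0 ≤ Z ω) {C r : ℝ}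
    (hCr : 0 < C * r) (hle : ∫⁻ ω, ENNReal.ofReal (Z ω) ∂P ≤ ENNReal.ofReal (C * r)) :
    ExpectationLE P Z C r := by
  have hint : Integrable Z P := by
    refine ⟨hZm.aestronglyMeasurable, ?_⟩
    rw [hasFiniteIntegral_iff_ofReal (ae_of_all _ hZ)]
    exact hle.trans_lt ENNReal.ofReal_lt_top
  have hI : ∫ ω, Z ω ∂P ≤ C * r := by
    rw [integral_eq_lintegral_of_nonneg_ae (ae_of_all _ hZ) hZm.aestronglyMeasurable]
    exact ENNReal.toReal_le_of_le_ofReal hCr.le hle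
  refine ⟨hint, hI, fun δ hδ _ 𝒢 h𝒢 => ?_⟩
  have hmeas : MeasurableSet[mΩ] {ω | (P[Z | 𝒢]) ω ≤ C / δ * r} :=
    h𝒢 _ (measurableSet_le stronglyMeasurable_condExp.measurable measurable_const)
  have hmarkov := mul_meas_ge_le_integral_of_nonneg
    (condExp_nonneg (m := 𝒢) (ae_of_all P hZ)) integrable_condExp (C / δ * r)
  rw [integral_condExp h𝒢] at hmarkov
  have hsub : {ω | (P[Z | 𝒢]) ω ≤ C / δ * r}ᶜ ⊆ {ω | C / δ * r ≤ (P[Z | 𝒢]) ω} := by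
    intro ω hω
    rw [Set.mem_compl_iff, Set.mem_ofPred_eq, not_le] at hω
    exact hω.le
  have h1 := measureReal_mono hsub (measure_ne_top P _)
  rw [probReal_compl_eq_one_sub hmeas] at h1
  have h2 : C / δ * r * P.real {ω | C / δ * r ≤ (P[Z | 𝒢]) ω} ≤ C * r := hmarkov.trans hI
  have h3 : C / δ * r = C * r / δ := by ring
  have h4 : P.real {ω | C / δ * r ≤ (P[Z | 𝒢]) ω} ≤ δ := by
    have h5 : C / δ * r * P.real {ω | C / δ * r ≤ (P[Z | 𝒢]) ω} ≤ C / δ * r * δ := by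
      refine h2.trans (le_of_eq ?_)
      field_simp
    -- Cancelling the threshold requires it to be strictly positive, which is the role of `hCr`.
    exact le_of_mul_le_mul_left h5 (by rw [h3]; positivity)
  linarith

end expectation

namespace Stream

/-! ### Stratified samples -/

section stratified

variable {ι ρ : Type*} {K : ℕ} (D : Stream ρ K) (t : ℕ)

/-- An upper bound, up to constants, for the squared error of a sample mean over a random sample
`S` of stratum `k`. -/
noncomputable def samplingError (k : Fin K) (S : Finset ρ) : ℝ :=
  if S.card < (D.cell t k).card then 1 / ((S.card : ℝ) + 1) else 0

variable {D t}

lemma samplingError_nonneg (k : Fin K) (S : Finset ρ) : 0 ≤ D.samplingError t k S := by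
  rw [samplingError]; split_ifs <;> positivity

lemma pos_map (S : Finset ρ) (e : ρ ≃ ρ) (he : ∀ z, D.oracle (e z) = D.oracle z) :
    D.pos (S.map e.toEmbedding) = (D.pos S).map e.toEmbedding := by
  ext z
  simp only [pos, mem_filter, mem_map_equiv]
  rw [← he (e.symm z), Equiv.apply_symm_apply]

variable [DecidableEq ρ]

variable (D t) in
/-- A finite family of samples of the strata of segment `t`, such that the sample of a uniformly
random index has a law that is invariant under transpositions within the strata. -/
structure Exchangeable (U : Finset ι) (X : ι → Fin K → Finset ρ) : Prop where
  subset_cell : ∀ u ∈ U, ∀ k, X u k ⊆ D.cell t k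
  swap : ∀ k, ∀ x ∈ D.cell t k, ∀ y ∈ D.cell t k, ∀ G : (Fin K → Finset ρ) → ℝ,
    ∑ u ∈ U, G (X u) = ∑ u ∈ U, G fun j => (X u j).map (Equiv.swap x y).toEmbedding

/-- Mean squared deviation of a sample mean from the stratum mean. -/
lemma Exchangeable.sum_sq_avg_sub_avg_le {U : Finset ι} {X : ι → Fin K → Finset ρ}
    (hX : D.Exchangeable t U X) (k : Fin K) (g : ρ → ℝ) :
    ∑ u ∈ U, (avg (X u k) g - avg (D.cell t k) g) ^ 2
      ≤ 2 * avg (D.cell t k) (fun x => g x ^ 2) * ∑ u ∈ U, D.samplingError t k (X u k) := by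
  set T := D.cell t k with hT
  set m := avg T g with hm
  set φ : ℕ → ℝ := fun n => if n < T.card then 1 else 0 with hφ
  have hφ0 : ∀ n, 0 ≤ φ n := fun n => by simp only [hφ]; split_ifs <;> norm_num
  have hV := avg_nonneg T (fun x => g x ^ 2) fun x _ => sq_nonneg _
  have hsum : ∑ x ∈ T, (g x - m) = 0 := by
    rw [sum_sub_distrib, sum_const, nsmul_eq_mul, hm, card_mul_avg, sub_self]
  have hvar := sum_sq_avg_le (φ := φ) (fun u hu => hX.subset_cell u hu k) hφ0 hsum
    fun x hx y hy G => hX.swap k x hx y hy fun Y => G (Y k)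
  -- A sample that exhausts the stratum has no error, hence the cut-off in `φ`. An empty sample has
  -- the default average `0` and squared error `m ^ 2`, which the second summand covers.
  have hpt : ∀ u ∈ U, (avg (X u k) g - m) ^ 2
      ≤ φ (X u k).card * avg (X u k) (fun x => g x - m) ^ 2
        + (if (X u k).card = 0 then φ 0 else 0) * avg T (fun x => g x ^ 2) := by
    intro u hu
    have hsub := hX.subset_cell u hu k
    rcases (X u k).eq_empty_or_nonempty with he | hne
    · rw [he]
      rcases T.eq_empty_or_nonempty with hTe | hTn
      · simp [hm, hTe, avg]
      · have h1 : φ 0 = 1 := by simp [hφ, hTn.card_pos]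
        have h2 := sq_avg_le T g
        rw [card_empty, h1]
        rw [← hm] at h2
        simpa [avg] using h2
    · have h0 : (X u k).card ≠ 0 := hne.card_pos.ne'
      rw [if_neg h0, zero_mul, add_zero, avg_sub_const _ hne]
      by_cases hlt : (X u k).card < T.card
      · simp [hφ, hlt]
      · have : X u k = T := eq_of_subset_of_card_le hsub (not_lt.1 hlt)
        rw [this, ← hm]; simp
  -- The factor `2` comes from `1 / n ≤ 2 / (n + 1)` for `n ≥ 1`; for `n = 0` the quotient is `0`
  -- and only the second term counts.
  have hR : ∀ u, φ (X u k).card / (X u k).card + (if (X u k).card = 0 then φ 0 else 0)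
      ≤ 2 * D.samplingError t k (X u k) := by
    intro u
    rw [samplingError, ← hT]
    by_cases h0 : (X u k).card = 0
    · simp only [h0, hφ]
      split_ifs <;> norm_num
    · rw [if_neg h0]
      have h1 : (1 : ℝ) ≤ (X u k).card := by exact_mod_cast Nat.one_le_iff_ne_zero.2 h0
      simp only [hφ]
      split_ifs
      · rw [add_zero, mul_one_div, div_le_div_iff₀ (by linarith) (by linarith)]
        linarith
      · norm_num
  calc ∑ u ∈ U, (avg (X u k) g - m) ^ 2
      ≤ ∑ u ∈ U, (φ (X u k).card * avg (X u k) (fun x => g x - m) ^ 2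
        + (if (X u k).card = 0 then φ 0 else 0) * avg T (fun x => g x ^ 2)) := sum_le_sum hpt
    _ ≤ (∑ u ∈ U, φ (X u k).card / (X u k).card) * avg T (fun x => g x ^ 2)
        + (∑ u ∈ U, if (X u k).card = 0 then φ 0 else 0) * avg T (fun x => g x ^ 2) := by
      rw [sum_add_distrib, ← sum_mul]
      refine add_le_add_left (hvar.trans ?_) _
      exact mul_le_mul_of_nonneg_left (avg_sq_sub_avg_le T g)
        (sum_nonneg fun u _ => div_nonneg (hφ0 _) (Nat.cast_nonneg _))
    _ ≤ (∑ u ∈ U, 2 * D.samplingError t k (X u k)) * avg T (fun x => g x ^ 2) := by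
      rw [← add_mul, ← sum_add_distrib]
      exact mul_le_mul_of_nonneg_right (sum_le_sum fun u _ => hR u) hV
    _ = 2 * avg T (fun x => g x ^ 2) * ∑ u ∈ U, D.samplingError t k (X u k) := by
      rw [← mul_sum]; ring

/-- The same for a weighted sum of sample means over all the strata. -/
lemma Exchangeable.sum_sq_weighted_le {U : Finset ι} {X : ι → Fin K → Finset ρ}
    (hX : D.Exchangeable t U X) {w : Fin K → ℝ} (hw0 : ∀ k, 0 ≤ w k) (hw1 : ∀ k, w k ≤ 1)
    {g : ρ → ℝ} {V : ℝ} (hV : ∀ k, avg (D.cell t k) (fun x => g x ^ 2) ≤ V) :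
    ∑ u ∈ U, (∑ k, w k * avg (X u k) g - ∑ k, w k * avg (D.cell t k) g) ^ 2
      ≤ 2 * K * V * ∑ u ∈ U, ∑ k, D.samplingError t k (X u k) := by
  have h1 : ∀ u ∈ U, (∑ k, w k * avg (X u k) g - ∑ k, w k * avg (D.cell t k) g) ^ 2
      ≤ K * ∑ k, (avg (X u k) g - avg (D.cell t k) g) ^ 2 := by
    intro u _
    rw [← sum_sub_distrib]
    refine sq_sum_le_card_mul_sum_sq.trans ?_
    rw [card_univ, Fintype.card_fin]
    refine mul_le_mul_of_nonneg_left (sum_le_sum fun k _ => ?_) (Nat.cast_nonneg _)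
    rw [← mul_sub, mul_pow]
    exact mul_le_of_le_one_left (sq_nonneg _) (pow_le_one₀ (hw0 k) (hw1 k))
  refine (sum_le_sum h1).trans ?_
  have h2 : ∀ k, ∑ u ∈ U, (avg (X u k) g - avg (D.cell t k) g) ^ 2
      ≤ 2 * V * ∑ u ∈ U, D.samplingError t k (X u k) := fun k =>
    (hX.sum_sq_avg_sub_avg_le k g).trans <| mul_le_mul_of_nonneg_right (by linarith [hV k])
      (sum_nonneg fun u _ => samplingError_nonneg _ _)
  have h3 := mul_le_mul_of_nonneg_left
    (sum_le_sum fun k (_ : k ∈ (univ : Finset (Fin K))) => h2 k) (Nat.cast_nonneg (α := ℝ) K)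
  rw [← mul_sum, sum_comm, sum_comm (s := U)]
  refine h3.trans (le_of_eq ?_)
  rw [← mul_sum]; ring

/-- Given the sample rates, the positive records of a sample are a uniformly random subset of the
positive records of the stratum. -/
lemma Exchangeable.sum_pHat_mul_avg_le {U : Finset ι} {X : ι → Fin K → Finset ρ}
    (hX : D.Exchangeable t U X) (k : Fin K) {F : (Fin K → ℝ) → ℝ} (hF : ∀ P, 0 ≤ F P)
    {q : ρ → ℝ} (hq : ∀ x, 0 ≤ q x) :
    ∑ u ∈ U, F (fun j => D.pHat (X u j)) * avg (D.pos (X u k)) q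
      ≤ (∑ u ∈ U, F fun j => D.pHat (X u j)) * avg (D.pos (D.cell t k)) q := by
  refine sum_mul_avg_le (fun u hu => filter_subset_filter _ (hX.subset_cell u hu k))
    (fun u _ => hF _) (fun x _ => hq x) fun x hx y hy => ?_
  have hx' := mem_filter.1 hx
  have hy' := mem_filter.1 hy
  -- Transposing two positive records of one stratum changes no oracle value, hence no sample rate,
  -- so the weight `F` is invariant.
  have he : ∀ z, D.oracle (Equiv.swap x y z) = D.oracle z := by
    intro z
    rw [Equiv.swap_apply_def]
    split_ifs with h1 h2
    · rw [h1, hx'.2, hy'.2]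
    · rw [h2, hx'.2, hy'.2]
    · rfl
  refine (hX.swap k x hx'.1 y hy'.1 fun Y => if x ∈ D.pos (Y k) then
    F (fun j => D.pHat (Y j)) / (D.pos (Y k)).card else 0).trans ?_
  refine sum_congr rfl fun u _ => ?_
  simp only [pHat, pos_map _ _ he, card_map, mem_map_equiv, Equiv.symm_swap,
    Equiv.swap_apply_left]

end stratified

/-! ### The error of the estimate -/

section error

variable {ρ : Type*} {K : ℕ} {D : Stream ρ K} {t : ℕ}

/-- The statistic, centred at `m`, on the positive records, and zero elsewhere. -/
noncomputable def centred (D : Stream ρ K) (m : ℝ) (x : ρ) : ℝ :=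
  if D.oracle x = true then D.f x - m else 0

lemma sum_ite_oracle (S : Finset ρ) (g : ρ → ℝ) :
    ∑ x ∈ S, (if D.oracle x = true then g x else 0) = ∑ x ∈ D.pos S, g x := by
  rw [pos, sum_filter]

lemma pHat_mul_avg (S : Finset ρ) (g : ρ → ℝ) :
    D.pHat S * avg (D.pos S) g = avg S fun x => if D.oracle x = true then g x else 0 := by
  rw [pHat, div_mul_eq_mul_div, card_mul_avg, avg, sum_ite_oracle]

lemma pHat_nonneg (S : Finset ρ) : 0 ≤ D.pHat S := by rw [pHat]; positivity

lemma pHat_le_one (S : Finset ρ) : D.pHat S ≤ 1 :=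
  div_le_one_of_le₀ (by exact_mod_cast card_filter_le _ _) (Nat.cast_nonneg _)

lemma pHat_eq_avg (S : Finset ρ) : D.pHat S = avg S fun x => if D.oracle x = true then 1 else 0 := by
  rw [avg, sum_ite_oracle, pHat]; simp

/-- This turns a mean over a random number of positive records into a mean over the whole sample, to
which the variance bound applies. Without positive records both sides vanish. -/
lemma pHat_mul_sub (S : Finset ρ) (m : ℝ) :
    D.pHat S * (D.muHat S - m) = avg S (D.centred m) := by
  rcases (D.pos S).eq_empty_or_nonempty with he | hne
  · rw [pHat, he]
    simp only [avg, centred, sum_ite_oracle, he]; simp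
  · rw [muHat, ← avg_sub_const _ hne, pHat_mul_avg]; rfl

lemma frac_nonneg (k : Fin K) : 0 ≤ D.frac t k := by rw [frac]; positivity

lemma frac_le_one (k : Fin K) : D.frac t k ≤ 1 :=
  div_le_one_of_le₀ (by exact_mod_cast card_filter_le _ _) (Nat.cast_nonneg _)

lemma frac_mul_avg (k : Fin K) (g : ρ → ℝ) :
    D.frac t k * avg (D.cell t k) g = (∑ x ∈ D.cell t k, g x) / (D.segment t).card := by
  rw [frac, div_mul_eq_mul_div, card_mul_avg]

lemma sum_cell (g : ρ → ℝ) : ∑ k, ∑ x ∈ D.cell t k, g x = ∑ x ∈ D.segment t, g x :=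
  sum_fiberwise (D.segment t) (D.stratum t) g

lemma sum_frac_mul_avg (g : ρ → ℝ) :
    ∑ k, D.frac t k * avg (D.cell t k) g = avg (D.segment t) g := by
  simp only [frac_mul_avg]
  rw [← sum_div, sum_cell, avg]

lemma sum_frac_mul_avg_centred_mean :
    ∑ k, D.frac t k * avg (D.cell t k) (D.centred (D.mean t)) = 0 := by
  rw [sum_frac_mul_avg, avg]
  simp only [centred]
  rw [sum_ite_oracle, sum_sub_distrib, sum_const, nsmul_eq_mul, mean, card_mul_avg]
  simp

lemma SubGaussian.avg_sq_le {c : ℝ} (hc : 0 < c) (hD : D.SubGaussian c) (k : Fin K) :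
    avg (D.pos (D.cell t k)) (fun x => D.f x ^ 2) ≤ c ^ 2 := by
  rcases (D.pos (D.cell t k)).eq_empty_or_nonempty with he | hne
  · rw [he]; simp [avg]; positivity
  · have h1 : avg (D.pos (D.cell t k)) (fun x => D.f x ^ 2)
        ≤ avg (D.pos (D.cell t k)) fun x => c ^ 2 * (Real.exp (D.f x ^ 2 / c ^ 2) - 1) := by
      refine avg_mono _ _ _ fun x _ => ?_
      -- Only the second moment is extracted from the sub-Gaussian condition, through `y ≤ exp y -
      -- 1`.
      have h2 := Real.add_one_le_exp (D.f x ^ 2 / c ^ 2)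
      calc D.f x ^ 2 = c ^ 2 * (D.f x ^ 2 / c ^ 2) := by field_simp
        _ ≤ _ := mul_le_mul_of_nonneg_left (by linarith) (sq_nonneg c)
    rw [avg_const_mul, avg_sub_const _ hne] at h1
    nlinarith [hD t k, sq_nonneg c]

lemma SubGaussian.sq_mean_le {c : ℝ} (hc : 0 < c) (hD : D.SubGaussian c) :
    D.mean t ^ 2 ≤ c ^ 2 := by
  refine (sq_avg_le _ _).trans ?_
  have h1 : ∑ x ∈ D.pos (D.segment t), D.f x ^ 2 ≤ c ^ 2 * (D.pos (D.segment t)).card := by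
    have h2 : ∀ g : ρ → ℝ, ∑ x ∈ D.pos (D.segment t), g x
        = ∑ k, ∑ x ∈ D.pos (D.cell t k), g x := by
      intro g
      simp only [← sum_ite_oracle]
      rw [sum_cell]
    have h3 : ((D.pos (D.segment t)).card : ℝ) = ∑ k, ((D.pos (D.cell t k)).card : ℝ) := by
      simpa using h2 fun _ => 1
    rw [h2, h3, mul_sum]
    refine sum_le_sum fun k _ => ?_
    rw [← card_mul_avg, mul_comm]
    exact mul_le_mul_of_nonneg_right (hD.avg_sq_le hc k) (Nat.cast_nonneg _)
  exact div_le_of_le_mul₀ (Nat.cast_nonneg _) (sq_nonneg c) h1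

lemma SubGaussian.avg_sq_sub_mean_le {c : ℝ} (hc : 0 < c) (hD : D.SubGaussian c) (k : Fin K) :
    avg (D.pos (D.cell t k)) (fun x => (D.f x - D.mean t) ^ 2) ≤ 4 * c ^ 2 := by
  have h1 : avg (D.pos (D.cell t k)) (fun x => (D.f x - D.mean t) ^ 2)
      ≤ avg (D.pos (D.cell t k)) fun x => 2 * D.f x ^ 2 + 2 * D.mean t ^ 2 :=
    avg_mono _ _ _ fun x _ => by nlinarith [sq_nonneg (D.f x + D.mean t)]
  rw [avg_add, avg_const_mul] at h1
  have h2 := avg_const_le (D.pos (D.cell t k)) (a := 2 * D.mean t ^ 2) (by positivity)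
  linarith [hD.avg_sq_le hc (t := t) k, hD.sq_mean_le hc (t := t)]

lemma SubGaussian.avg_sq_centred_le {c : ℝ} (hc : 0 < c) (hD : D.SubGaussian c) (k : Fin K) :
    avg (D.cell t k) (fun x => D.centred (D.mean t) x ^ 2) ≤ 4 * c ^ 2 := by
  have h1 : avg (D.cell t k) (fun x => D.centred (D.mean t) x ^ 2)
      = D.pHat (D.cell t k) * avg (D.pos (D.cell t k)) fun x => (D.f x - D.mean t) ^ 2 := by
    rw [pHat_mul_avg]
    congr 1; ext x
    rw [centred]; split_ifs <;> simp
  rw [h1]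
  refine (mul_le_of_le_one_left (avg_nonneg _ _ fun x _ => sq_nonneg _) (pHat_le_one _)).trans ?_
  exact hD.avg_sq_sub_mean_le hc k

/-- A bound for the squared error by the deviations of numerator and denominator of the estimate. -/
lemma sq_estimate_sub_mean_le {b : ℝ} (hb : 0 < b) (hseg : (D.segment t).card ≠ 0)
    (Y : Fin K → Finset ρ) :
    (D.estimate t Y - D.mean t) ^ 2
      ≤ 4 / b ^ 2 * (∑ k, D.frac t k * avg (Y k) (D.centred (D.mean t))) ^ 2
        + 4 / b ^ 2 * ((∑ k, D.frac t k * D.pHat (Y k) - b) ^ 2 *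
          (∑ k, avg (D.pos (Y k)) (fun x => (D.f x - D.mean t) ^ 2) + D.mean t ^ 2)) := by
  set m := D.mean t
  set B := ∑ k, D.frac t k * D.pHat (Y k) with hB
  have hs : ((D.segment t).card : ℝ) ≠ 0 := by exact_mod_cast hseg
  have hcard : ∀ k, ((D.cell t k).card : ℝ) = D.frac t k * (D.segment t).card := by
    intro k; rw [frac]; field_simp
  have hest : D.estimate t Y = ∑ k, D.muHat (Y k) * (D.frac t k * D.pHat (Y k) / B) := by
    rw [estimate]
    refine sum_congr rfl fun k _ => ?_
    have : ∑ j, D.pHat (Y j) * ((D.cell t j).card : ℝ) = B * (D.segment t).card := by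
      rw [hB, sum_mul]
      exact sum_congr rfl fun j _ => by rw [hcard]; ring
    rw [this, hcard, ← mul_div_mul_right (D.frac t k * D.pHat (Y k)) B hs]
    congr 2; ring
  have hterm0 : ∀ k, 0 ≤ D.frac t k * D.pHat (Y k) :=
    fun k => mul_nonneg (frac_nonneg k) (pHat_nonneg _)
  have hB0 : 0 ≤ B := sum_nonneg fun k _ => hterm0 k
  set Q := ∑ k, avg (D.pos (Y k)) (fun x => (D.f x - m) ^ 2) with hQ
  have hQk : ∀ k, 0 ≤ avg (D.pos (Y k)) (fun x => (D.f x - m) ^ 2) :=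
    fun k => avg_nonneg _ _ fun x _ => sq_nonneg _
  have hQ0 : 0 ≤ Q := sum_nonneg fun k _ => hQk k
  have hdiff : B ≠ 0 →
      D.estimate t Y - m = ∑ k, (D.frac t k * D.pHat (Y k) / B) * (D.muHat (Y k) - m) := by
    intro hBne
    have h1 : ∑ k, D.frac t k * D.pHat (Y k) / B = 1 := by
      rw [← sum_div, ← hB, div_self hBne]
    simp only [mul_sub]
    rw [sum_sub_distrib, ← sum_mul, h1, one_mul, hest]
    simp only [mul_comm]
  -- For `B ≥ b / 2` dividing by `B` costs at most `2 / b`. For `B < b / 2` a crude bound on the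
  -- error is multiplied by `4 / b ^ 2 * (B - b) ^ 2 ≥ 1`.
  rcases le_or_gt (b / 2) B with hle | hlt
  · have hBpos : 0 < B := by linarith
    have h1 : D.estimate t Y - m = (∑ k, D.frac t k * avg (Y k) (D.centred m)) / B := by
      rw [hdiff hBpos.ne', sum_div]
      refine sum_congr rfl fun k _ => ?_
      rw [← pHat_mul_sub]; ring
    have h2 : (D.estimate t Y - m) ^ 2
        ≤ 4 / b ^ 2 * (∑ k, D.frac t k * avg (Y k) (D.centred m)) ^ 2 := by
      rw [h1, div_pow, div_mul_eq_mul_div, div_le_div_iff₀ (by positivity) (by positivity)]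
      have : b ^ 2 ≤ 4 * B ^ 2 := by nlinarith
      nlinarith [sq_nonneg (∑ k, D.frac t k * avg (Y k) (D.centred m))]
    have h3 : 0 ≤ 4 / b ^ 2 * ((B - b) ^ 2 * (Q + m ^ 2)) := by positivity
    linarith
  · have h1 : (D.estimate t Y - m) ^ 2 ≤ Q + m ^ 2 := by
      rcases hB0.eq_or_lt with h0 | hBpos
      -- Without positive samples the estimate is `0` by convention; this is the origin of the
      -- summand `m ^ 2`.
      · have : D.estimate t Y = 0 := by rw [hest, ← h0]; simp
        rw [this]; nlinarith
      · rw [hdiff hBpos.ne']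
        -- The estimate is a convex combination of the sample means, so Jensen's inequality applies
        -- to the square.
        have hjensen := (even_two.convexOn_pow (𝕜 := ℝ)).map_sum_le
          (t := (univ : Finset (Fin K))) (w := fun k => D.frac t k * D.pHat (Y k) / B)
          (p := fun k => D.muHat (Y k) - m) (fun k _ => div_nonneg (hterm0 k) hB0)
          (by rw [← sum_div, ← hB, div_self hBpos.ne']) fun k _ => Set.mem_univ _
        simp only [smul_eq_mul] at hjensen
        refine hjensen.trans ((sum_le_sum fun k _ => ?_).trans (le_add_of_nonneg_right (sq_nonneg m)))
        rcases (D.pos (Y k)).eq_empty_or_nonempty with he | hne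
        · rw [pHat, he]; simp [avg]
        · have h2 : (D.muHat (Y k) - m) ^ 2 ≤ avg (D.pos (Y k)) fun x => (D.f x - m) ^ 2 := by
            rw [muHat, ← avg_sub_const _ hne]
            exact sq_avg_le _ _
          refine (mul_le_of_le_one_left (sq_nonneg _) ?_).trans h2
          refine div_le_one_of_le₀ ?_ hB0
          exact single_le_sum (f := fun k => D.frac t k * D.pHat (Y k)) (fun k _ => hterm0 k)
            (mem_univ k)
    have h2 : 1 ≤ 4 / b ^ 2 * (B - b) ^ 2 := by
      rw [div_mul_eq_mul_div, le_div_iff₀ (by positivity)]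
      nlinarith
    have h3 : 0 ≤ 4 / b ^ 2 * (∑ k, D.frac t k * avg (Y k) (D.centred m)) ^ 2 := by positivity
    have h4 : Q + m ^ 2 ≤ 4 / b ^ 2 * (B - b) ^ 2 * (Q + m ^ 2) :=
      le_mul_of_one_le_left (by positivity) h2
    rw [mul_assoc] at h4
    linarith

/-- The mean squared error for an exchangeable stratified sample. -/
lemma Exchangeable.sum_sq_estimate_sub_mean_le [DecidableEq ρ] {ι : Type*} {U : Finset ι}
    {X : ι → Fin K → Finset ρ} (hX : D.Exchangeable t U X) {c b : ℝ} (hc : 0 < c)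
    (hD : D.SubGaussian c) (hb : 0 < b) (hbsum : ∑ k, D.frac t k * D.posRate t k = b)
    (hseg : (D.segment t).card ≠ 0) :
    ∑ u ∈ U, (D.estimate t (X u) - D.mean t) ^ 2
      ≤ 4 / b ^ 2 * (2 * K * (4 * c ^ 2) + 2 * K * (K * (4 * c ^ 2) + c ^ 2))
        * ∑ u ∈ U, ∑ k, D.samplingError t k (X u k) := by
  set R := ∑ u ∈ U, ∑ k, D.samplingError t k (X u k) with hR
  set m := D.mean t with hm
  set F : (Fin K → ℝ) → ℝ := fun P => (∑ k, D.frac t k * P k - b) ^ 2 with hF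
  have hF0 : ∀ P, 0 ≤ F P := fun P => sq_nonneg _
  have hnum : ∑ u ∈ U, (∑ k, D.frac t k * avg (X u k) (D.centred m)) ^ 2
      ≤ 2 * K * (4 * c ^ 2) * R := by
    have := hX.sum_sq_weighted_le (w := D.frac t) frac_nonneg frac_le_one
      (g := D.centred m) (hD.avg_sq_centred_le hc)
    simpa only [sum_frac_mul_avg_centred_mean, sub_zero, hm] using this
  have hden : ∑ u ∈ U, F (fun k => D.pHat (X u k)) ≤ 2 * K * R := by
    have := hX.sum_sq_weighted_le (w := D.frac t) frac_nonneg frac_le_one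
      (g := fun x => if D.oracle x = true then 1 else 0) (V := 1) fun k => by
        refine (avg_mono _ _ (fun _ => 1) fun x _ => ?_).trans (avg_const_le _ zero_le_one)
        split_ifs <;> norm_num
    simp only [← pHat_eq_avg] at this
    rw [mul_one] at this
    refine le_trans (le_of_eq ?_) this
    simp only [hF, ← hbsum]; rfl
  -- Here `F` and the sample second moments are dependent, but conditioning on the sample rates
  -- separates them, without fourth moments of the statistic.
  have hquot : ∑ u ∈ U, F (fun k => D.pHat (X u k)) *
      (∑ k, avg (D.pos (X u k)) (fun x => (D.f x - m) ^ 2) + m ^ 2)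
      ≤ 2 * K * R * (K * (4 * c ^ 2) + c ^ 2) := by
    have h1 : ∀ k, ∑ u ∈ U, F (fun k => D.pHat (X u k)) *
        avg (D.pos (X u k)) (fun x => (D.f x - m) ^ 2)
        ≤ (∑ u ∈ U, F fun k => D.pHat (X u k)) * (4 * c ^ 2) := fun k =>
      (hX.sum_pHat_mul_avg_le k hF0 fun x => sq_nonneg _).trans
        (mul_le_mul_of_nonneg_left (hD.avg_sq_sub_mean_le hc k) (sum_nonneg fun u _ => hF0 _))
    have h2 := sum_le_sum fun k (_ : k ∈ (univ : Finset (Fin K))) => h1 k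
    rw [sum_const, card_univ, Fintype.card_fin, nsmul_eq_mul, sum_comm] at h2
    simp only [mul_add, sum_add_distrib, mul_sum (s := (univ : Finset (Fin K))), ← sum_mul]
    have h3 : (∑ u ∈ U, F fun k => D.pHat (X u k)) * m ^ 2
        ≤ (∑ u ∈ U, F fun k => D.pHat (X u k)) * c ^ 2 :=
      mul_le_mul_of_nonneg_left (hD.sq_mean_le hc) (sum_nonneg fun u _ => hF0 _)
    have h4 := mul_le_mul_of_nonneg_right hden
      (show (0 : ℝ) ≤ K * (4 * c ^ 2) + c ^ 2 by positivity)
    linarith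
  refine (sum_le_sum fun u _ => sq_estimate_sub_mean_le hb hseg (X u)).trans ?_
  rw [sum_add_distrib, ← mul_sum, ← mul_sum, ← mul_add, mul_assoc]
  refine mul_le_mul_of_nonneg_left ?_ (by positivity)
  linarith

end error

/-! ### The sampling laws of the algorithm -/

section laws

variable {ρ : Type*} {K : ℕ} {D : Stream ρ K} {t : ℕ}

lemma rawAlloc_nonneg (Y : Fin K → Finset ρ) (k : Fin K) : 0 ≤ D.rawAlloc t Y k :=
  div_nonneg (mul_nonneg (mul_nonneg (Real.sqrt_nonneg _) (frac_nonneg k)) (Real.sqrt_nonneg _))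
    (sum_nonneg fun j _ =>
      mul_nonneg (mul_nonneg (Real.sqrt_nonneg _) (frac_nonneg j)) (Real.sqrt_nonneg _))

/-- The defensive budget bounds the sampling error from above in every stratum. -/
lemma samplingError_reservoir_le {N₁ N₂ : ℕ} (hN₁ : 0 < N₁) (h : History ρ K t) (k : Fin K)
    {S : Finset ρ} (hS : S.card = D.sampleSize 0 N₁ N₂ h k) :
    D.samplingError t k S ≤ K / N₁ := by
  have hN : (0 : ℝ) < N₁ := by exact_mod_cast hN₁
  have hK : (0 : ℝ) < K := by exact_mod_cast k.pos
  rw [samplingError]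
  split_ifs with hlt
  · have hewma : 0 ≤ ewma 0 t fun s => D.rawAlloc s (h s) k := by
      simp only [ewma, sub_zero, one_pow, one_mul]
      exact div_nonneg (sum_nonneg fun s _ => rawAlloc_nonneg _ _) (by simp)
    have hbudget : (N₁ : ℝ) / K ≤ ((N₁ : ℝ) + N₂) * D.alloc 0 N₁ N₂ h k := by
      have : ((N₁ : ℝ) + N₂) ≠ 0 := by positivity
      rw [alloc, mul_div_cancel₀ _ this]
      exact le_add_of_nonneg_right (by positivity)
    have hcard : S.card = ⌊((N₁ : ℝ) + N₂) * D.alloc 0 N₁ N₂ h k⌋₊ := by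
      rw [hS, sampleSize] at hlt ⊢
      omega
    -- The `+ 1` in `samplingError` absorbs the rounding down, so `N₁ < K` needs no separate
    -- treatment.
    have hfloor := Nat.lt_floor_add_one (((N₁ : ℝ) + N₂) * D.alloc 0 N₁ N₂ h k)
    rw [← hcard] at hfloor
    rw [div_le_div_iff₀ (by positivity) hN, one_mul]
    rw [div_le_iff₀ hK] at hbudget
    nlinarith
  · positivity

variable [DecidableEq ρ]

lemma stratum_swap {k : Fin K} {x y : ρ} (hx : x ∈ D.cell t k) (hy : y ∈ D.cell t k) (z : ρ) :
    D.stratum t (Equiv.swap x y z) = D.stratum t z := by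
  have hx' := (mem_filter.1 hx).2
  have hy' := (mem_filter.1 hy).2
  rw [Equiv.swap_apply_def]
  split_ifs with h1 h2
  · rw [h1, hx', hy']
  · rw [h2, hx', hy']
  · rfl

lemma swap_mem_cell {k : Fin K} {x y : ρ} (hx : x ∈ D.cell t k) (hy : y ∈ D.cell t k) {z : ρ}
    {j : Fin K} (hz : z ∈ D.cell t j) : Equiv.swap x y z ∈ D.cell t j := by
  have hz' := mem_filter.1 hz
  refine mem_filter.2 ⟨?_, by rw [stratum_swap hx hy, hz'.2]⟩
  rw [Equiv.swap_apply_def]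
  split_ifs
  · exact (mem_filter.1 hy).1
  · exact (mem_filter.1 hx).1
  · exact hz'.1

/-- A uniformly random subset of the segment of given size, split by strata, is exchangeable. -/
lemma exchangeable_powersetCard (D : Stream ρ K) (t n : ℕ) :
    D.Exchangeable t ((D.segment t).powersetCard n)
      fun S k => S.filter fun x => D.stratum t x = k where
  subset_cell S hS k := filter_subset_filter _ (mem_powersetCard.1 hS).1
  swap k x hx y hy G := by
    rw [sum_powersetCard_swap n (mem_filter.1 hx).1 (mem_filter.1 hy).1]
    refine sum_congr rfl fun S _ => ?_
    congr 1
    ext j z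
    simp only [mem_filter, mem_map_equiv, Equiv.symm_swap, stratum_swap hx hy]

/-- Independent uniformly random subsets of the strata, of given sizes, are exchangeable. -/
lemma exchangeable_piFinset (D : Stream ρ K) (t : ℕ) (n : Fin K → ℕ) :
    D.Exchangeable t (Fintype.piFinset fun k => (D.cell t k).powersetCard (n k)) fun Y => Y where
  subset_cell Y hY k := (mem_powersetCard.1 (Fintype.mem_piFinset.1 hY k)).1
  swap k x hx y hy G := by
    set e := (Equiv.swap x y).toEmbedding
    have hinv : ∀ Y : Fin K → Finset ρ, (fun j => ((Y j).map e).map e) = Y := by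
      intro Y; ext j z; simp [e, mem_map_equiv]
    have hmem : ∀ Y ∈ Fintype.piFinset fun k => (D.cell t k).powersetCard (n k),
        (fun j => (Y j).map e) ∈ Fintype.piFinset fun k => (D.cell t k).powersetCard (n k) := by
      intro Y hY
      rw [Fintype.mem_piFinset] at hY ⊢
      intro j
      have hj := mem_powersetCard.1 (hY j)
      refine mem_powersetCard.2 ⟨fun z hz => ?_, by rw [card_map, hj.2]⟩
      rw [mem_map_equiv, Equiv.symm_swap] at hz
      simpa using swap_mem_cell hx hy (hj.1 hz)
    exact sum_nbij' (fun Y j => (Y j).map e) (fun Y j => (Y j).map e) hmem hmem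
      (fun Y _ => hinv Y) (fun Y _ => hinv Y) fun Y _ => by rw [hinv]

/-- Expected sampling error of the pilot sample. -/
lemma avg_samplingError_pilot_le {N : ℕ} (hN : 0 < N) (k : Fin K) :
    avg ((D.segment t).powersetCard (min N (D.segment t).card))
      (fun S => D.samplingError t k (S.filter fun x => D.stratum t x = k))
      ≤ 6 / D.frac t k ^ 2 / N := by
  set T := D.segment t with hT
  set U := T.powersetCard (min N T.card) with hU
  set w := D.frac t k with hw
  have hw0 : 0 ≤ w := frac_nonneg k
  have hw1 : w ≤ 1 := frac_le_one k
  have hN' : (0 : ℝ) < N := by exact_mod_cast hN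
  have hrhs : 0 ≤ 6 / w ^ 2 / N := by positivity
  have hzero : (∀ S ∈ U, D.samplingError t k (S.filter fun x => D.stratum t x = k) = 0) →
      avg U (fun S => D.samplingError t k (S.filter fun x => D.stratum t x = k))
        ≤ 6 / w ^ 2 / N := by
    intro h
    rw [avg, sum_congr rfl h]
    simpa
  rcases le_or_gt T.card N with hle | hlt
  · refine hzero fun S hS => ?_
    have hST := mem_powersetCard.1 hS
    rw [min_eq_right hle] at hST
    rw [eq_of_subset_of_card_le hST.1 hST.2.ge, samplingError, cell, if_neg (lt_irrefl _)]
  -- For `w = 0` the stratum is empty and the right-hand side is `0`, by the convention for division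
  -- by zero.
  rcases hw0.eq_or_lt with h0 | hwpos
  · refine hzero fun S hS => ?_
    have hcell : D.cell t k = ∅ := by
      have hT0 : (T.card : ℝ) ≠ 0 := by exact_mod_cast (hN.trans hlt).ne'
      have h1 : (D.cell t k).card / (T.card : ℝ) = 0 := h0.symm
      rw [div_eq_zero_iff, or_iff_left hT0] at h1
      exact card_eq_zero.1 (by exact_mod_cast h1)
    rw [samplingError, hcell]; simp
  have hTne : T.Nonempty := card_pos.1 (hN.trans hlt)
  have hUne : U.Nonempty := powersetCard_nonempty.2 (min_le_right _ _)
  set h : ρ → ℝ := fun x => (if D.stratum t x = k then 1 else 0) - w with hh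
  have hsum : ∑ x ∈ T, h x = 0 := by
    have hT0 : (T.card : ℝ) ≠ 0 := by exact_mod_cast (hN.trans hlt).ne'
    simp only [hh]
    rw [sum_sub_distrib, sum_boole, sum_const, nsmul_eq_mul, hw, frac, cell]
    field_simp
    ring
  have hvar := sum_sq_avg_le (U := U) (S := fun S => S) (T := T) (φ := fun _ => 1)
    (fun S hS => (mem_powersetCard.1 hS).1) (fun _ => zero_le_one) hsum
    fun x hx y hy G => sum_powersetCard_swap _ hx hy G
  have hcard : ∀ S ∈ U, (S.card : ℝ) = N := by
    intro S hS
    rw [(mem_powersetCard.1 hS).2, min_eq_left hlt.le]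
  have hh1 : avg T (fun x => h x ^ 2) ≤ 1 := by
    refine (avg_mono _ _ (fun _ => 1) fun x _ => ?_).trans (avg_const_le _ zero_le_one)
    simp only [hh]
    split_ifs <;> nlinarith
  -- Chebyshev's argument: either the stratum receives at least half of its expected `N * w` draws,
  -- or its share deviates from `w` by at least `w / 2` and the second term is at least `1`.
  have hpt : ∀ S ∈ U, D.samplingError t k (S.filter fun x => D.stratum t x = k)
      ≤ 2 / (N * w) + 4 / w ^ 2 * avg S h ^ 2 := by
    intro S hS
    have hS0 : S.Nonempty := by
      rw [← card_pos]
      have := hcard S hS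
      have h1 : (0 : ℝ) < S.card := by rw [this]; exact hN'
      exact_mod_cast h1
    set n : ℝ := ((S.filter fun x => D.stratum t x = k).card : ℝ) with hn
    have hn0 : 0 ≤ n := Nat.cast_nonneg _
    have havg : avg S h = n / N - w := by
      simp only [hh]
      rw [avg_sub_const _ hS0, avg, sum_boole, hcard S hS]
    have hle1 : D.samplingError t k (S.filter fun x => D.stratum t x = k) ≤ 1 / (n + 1) := by
      rw [samplingError]
      split_ifs
      · exact le_rfl
      · positivity
    refine hle1.trans ?_
    rw [havg]
    rcases le_or_gt (N * w / 2) n with hge | hlt'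
    · have h1 : 1 / (n + 1) ≤ 2 / (N * w) := by
        rw [div_le_div_iff₀ (by linarith) (by positivity)]
        linarith
      have h2 : 0 ≤ 4 / w ^ 2 * (n / N - w) ^ 2 := by positivity
      linarith
    · have h1 : 1 / (n + 1) ≤ 1 := by rw [div_le_one (by linarith)]; linarith
      have h2 : n / N ≤ w / 2 := by
        rw [div_le_iff₀ hN']; linarith
      have h3 : 1 ≤ 4 / w ^ 2 * (n / N - w) ^ 2 := by
        rw [div_mul_eq_mul_div, le_div_iff₀ (by positivity)]
        nlinarith
      have h4 : 0 ≤ 2 / (N * w) := by positivity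
      linarith
  have hvar' : avg U (fun S => avg S h ^ 2) ≤ 1 / N := by
    rw [avg, div_le_iff₀ (by exact_mod_cast hUne.card_pos)]
    simp only [one_mul] at hvar
    refine hvar.trans ?_
    rw [sum_congr rfl fun S hS => by rw [hcard S hS], sum_const, nsmul_eq_mul, mul_comm (1 / (N : ℝ))]
    exact mul_le_of_le_one_right (by positivity) hh1
  calc avg U (fun S => D.samplingError t k (S.filter fun x => D.stratum t x = k))
      ≤ avg U (fun S => 2 / (N * w) + 4 / w ^ 2 * avg S h ^ 2) := avg_mono _ _ _ hpt
    _ = 2 / (N * w) + 4 / w ^ 2 * avg U (fun S => avg S h ^ 2) := by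
      rw [avg_add, avg_const hUne, avg_const_mul]
    _ ≤ 2 / (N * w) + 4 / w ^ 2 * (1 / N) := by gcongr
    _ ≤ 2 / (N * w ^ 2) + 4 / w ^ 2 * (1 / N) := by
      gcongr
      nlinarith
    _ = 6 / w ^ 2 / N := by field_simp; ring

end laws

/-! ### From the conditional error bound to the joint law -/

/-- Given the samples of the earlier segments, the expected squared error is of the order of the
inverse of the defensive budget. -/
lemma tsum_segmentLaw_le {ρ : Type*} {K : ℕ} {D : Stream ρ K} {c b : ℝ} {w : Fin K → ℝ}
    (hc : 0 < c) (hD : D.SubGaussian c) (hb : 0 < b) {t : ℕ} (hw : ∀ k, D.frac t k = w k)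
    (hbsum : ∑ k, D.frac t k * D.posRate t k = b) (hseg : (D.segment t).card ≠ 0)
    {N₁ N₂ : ℕ} (hN₁ : 0 < N₁) (h : History ρ K t) :
    ∑' Y, D.segmentLaw 0 N₁ N₂ t h Y * ENNReal.ofReal ((D.estimate t Y - D.mean t) ^ 2)
      ≤ ENNReal.ofReal (4 / b ^ 2 * (2 * K * (4 * c ^ 2) + 2 * K * (K * (4 * c ^ 2) + c ^ 2))
        * (∑ k, (6 / w k ^ 2 + K)) / N₁) := by
  classical
  have hN : (0 : ℝ) < N₁ := by exact_mod_cast hN₁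
  set A := 4 / b ^ 2 * (2 * K * (4 * c ^ 2) + 2 * K * (K * (4 * c ^ 2) + c ^ 2))
  have hA : 0 ≤ A := by positivity
  -- One bound serves both laws: `6 / w k ^ 2` comes from the pilot segment and `K` from the
  -- defensive budget.
  have key : ∀ {ι : Type _} (U : Finset ι) (X : ι → Fin K → Finset ρ), D.Exchangeable t U X →
      (∀ k, avg U (fun u => D.samplingError t k (X u k)) ≤ (6 / w k ^ 2 + K) / N₁) →
      avg U (fun u => (D.estimate t (X u) - D.mean t) ^ 2)
        ≤ A * (∑ k, (6 / w k ^ 2 + K)) / N₁ := by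
    intro ι U X hX hR
    have h1 := div_le_div_of_nonneg_right
      (hX.sum_sq_estimate_sub_mean_le hc hD hb hbsum hseg) (Nat.cast_nonneg (α := ℝ) U.card)
    refine h1.trans ?_
    rw [mul_div_assoc, mul_div_assoc, sum_comm, sum_div, sum_div]
    exact mul_le_mul_of_nonneg_left (sum_le_sum fun k _ => hR k) hA
  cases t with
  | zero =>
    rw [segmentLaw, pilotLaw, tsum_map_mul, tsum_uniformOfFinset_mul _ _ fun _ => sq_nonneg _]
    refine ENNReal.ofReal_le_ofReal (key _ _ (exchangeable_powersetCard D 0 _) fun k => ?_)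
    refine (avg_samplingError_pilot_le (Nat.add_pos_left hN₁ N₂) k).trans ?_
    rw [hw]
    push_cast
    gcongr
    · exact le_add_of_nonneg_right (Nat.cast_nonneg _)
    · exact le_add_of_nonneg_right (Nat.cast_nonneg _)
  | succ t =>
    rw [segmentLaw, reservoirLaw, tsum_uniformOfFinset_mul _ _ fun _ => sq_nonneg _]
    refine ENNReal.ofReal_le_ofReal (key _ _ (exchangeable_piFinset D (t + 1) _) fun k => ?_)
    refine (avg_mono _ _ (fun _ => (K : ℝ) / N₁) fun Y hY => ?_).trans
      ((avg_const_le _ (by positivity)).trans ?_)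
    · exact samplingError_reservoir_le hN₁ h k
        (mem_powersetCard.1 (Fintype.mem_piFinset.1 hY k)).2
    · gcongr
      exact le_add_of_nonneg_left (by positivity)

/-- The error involves only the last segment, so a bound uniform in the history survives averaging
over histories. -/
lemma lintegral_sqError_le {ρ : Type*} {K : ℕ} {D : Stream ρ K} {N₁ N₂ t : ℕ} {M : ℝ≥0∞}
    (hM : ∀ h : History ρ K t, ∑' Y, D.segmentLaw 0 N₁ N₂ t h Y *
      ENNReal.ofReal ((D.estimate t Y - D.mean t) ^ 2) ≤ M) :
    ∫⁻ h, ENNReal.ofReal (D.sqError t h) ∂(D.historyLaw 0 N₁ N₂ (t + 1)).toMeasure ≤ M := by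
  have : MeasurableSingletonClass (History ρ K (t + 1)) := ⟨fun _ => trivial⟩
  rw [lintegral_toMeasure, historyLaw, tsum_bind_mul]
  calc _ ≤ ∑' h, D.historyLaw 0 N₁ N₂ t h * M := by
        refine ENNReal.tsum_le_tsum fun h => mul_le_mul_right ?_ _
        refine ((tsum_map_mul (β := History ρ K (t + 1)) _ _ _).trans ?_).le.trans (hM h)
        refine tsum_congr fun Y => ?_
        have hlast : (Fin.snoc h Y : Fin (t + 1) → Fin K → Finset ρ) (Fin.last t) = Y :=
          Fin.snoc_last (α := fun _ => Fin K → Finset ρ) _ _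
        change _ * ENNReal.ofReal ((D.estimate t
          ((Fin.snoc h Y : Fin (t + 1) → Fin K → Finset ρ) (Fin.last t)) - D.mean t) ^ 2) = _
        rw [hlast]
    _ = M := by rw [ENNReal.tsum_mul_right, PMF.tsum_coe, one_mul]

end Stream

end InQuest

/-! ### Choice of the constant and conclusion -/

theorem theorem2 (K : ℕ) (p w σ : Fin K → ℝ) (c : ℝ) (hc : 0 < c)
    (hp : ∃ k, p k ≠ 0) (hσ : ∀ k, p k ≠ 0 → σ k ≠ 0) :
    ∃ C : ℝ, 0 < C ∧
      ∀ (ρ : Type*) (D : InQuest.Stream ρ K), D.Stationary p w σ → D.SubGaussian c →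
        ∀ N₁ N₂ : ℕ, 0 < N₁ → 0 < N₂ → ∀ t : ℕ,
          InQuest.ExpectationLE (D.historyLaw 0 N₁ N₂ (t + 1)).toMeasure (D.sqError t) C
            (1 / (N₁ : ℝ) + N₁ / (N₂ : ℝ) ^ 2 + 1 / (N₂ * √(N₁ : ℝ))
              + 1 / (N₂ * √((N₁ : ℝ) * ((t + 1 : ℕ) : ℝ)))) ∧
          (N₁ = N₂ →
            InQuest.ExpectationLE (D.historyLaw 0 N₁ N₂ (t + 1)).toMeasure (D.sqError t) C
              (1 / ((N₁ : ℝ) + N₂))) := by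
  set b := ∑ k, w k * p k with hb
  set A := 4 / b ^ 2 * (2 * K * (4 * c ^ 2) + 2 * K * (K * (4 * c ^ 2) + c ^ 2))
    * ∑ k, (6 / w k ^ 2 + K) with hA
  have hA0 : 0 ≤ A := mul_nonneg (by positivity) (Finset.sum_nonneg fun k _ => by positivity)
  -- The factor `2` serves `N₁ = N₂`, where `1 / N` equals `1 / (2 * N₁)`. The `+ 1` keeps the
  -- constant positive even if `A = 0`; at this point no stream is available to show `b ≠ 0`.
  refine ⟨2 * A + 1, by positivity, fun ρ D hst hsub N₁ N₂ hN₁ hN₂ t => ?_⟩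
  have hN₁' : (0 : ℝ) < N₁ := by exact_mod_cast hN₁
  have hN₂' : (0 : ℝ) < N₂ := by exact_mod_cast hN₂
  obtain ⟨k₀, hk₀⟩ := hp
  -- Since `0 / 0 = 0`, a nonzero rate forces the stratum to be nonempty in every segment.
  have hcell : ((D.cell t k₀).card : ℝ) ≠ 0 := by
    intro h0
    apply hk₀
    rw [← hst.posRate_eq t, InQuest.Stream.posRate, h0, div_zero]
  have hseg : (D.segment t).card ≠ 0 := by
    have h1 : 0 < (D.cell t k₀).card := Nat.pos_of_ne_zero (by exact_mod_cast hcell)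
    exact (h1.trans_le (Finset.card_filter_le _ _)).ne'
  have hseg' : ((D.segment t).card : ℝ) ≠ 0 := by exact_mod_cast hseg
  have hp0 : ∀ k, 0 ≤ p k := fun k => by
    rw [← hst.posRate_eq t]; exact InQuest.Stream.pHat_nonneg _
  have hw0 : ∀ k, 0 ≤ w k := fun k => by
    rw [← hst.frac_eq t]; exact InQuest.Stream.frac_nonneg _
  have hwk : w k₀ ≠ 0 := by
    rw [← hst.frac_eq t]; exact div_ne_zero hcell hseg'
  have hbpos : 0 < b := Finset.sum_pos' (fun k _ => mul_nonneg (hw0 k) (hp0 k))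
    ⟨k₀, Finset.mem_univ _, mul_pos ((hw0 k₀).lt_of_ne' hwk) ((hp0 k₀).lt_of_ne' hk₀)⟩
  have hbsum : ∑ k, D.frac t k * D.posRate t k = b := by
    simp only [hst.frac_eq, hst.posRate_eq, hb]
  have hint : ∫⁻ h, ENNReal.ofReal (D.sqError t h) ∂(D.historyLaw 0 N₁ N₂ (t + 1)).toMeasure
      ≤ ENNReal.ofReal (A / N₁) :=
    InQuest.Stream.lintegral_sqError_le fun h =>
      InQuest.Stream.tsum_segmentLaw_le hc hsub hbpos (hst.frac_eq t) hbsum hseg hN₁ h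
  have main : ∀ r : ℝ, 0 < r → 1 / (2 * (N₁ : ℝ)) ≤ r →
      InQuest.ExpectationLE (D.historyLaw 0 N₁ N₂ (t + 1)).toMeasure (D.sqError t)
        (2 * A + 1) r := by
    intro r hr hle
    refine InQuest.expectationLE_of_lintegral_le _ measurable_from_top (fun h => sq_nonneg _)
      (by positivity) (hint.trans (ENNReal.ofReal_le_ofReal ?_))
    calc A / N₁ = 2 * A * (1 / (2 * N₁)) := by field_simp
      _ ≤ 2 * A * r := by gcongr
      _ ≤ (2 * A + 1) * r := by nlinarith
  have hhalf : 1 / (2 * (N₁ : ℝ)) ≤ 1 / N₁ := by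
    gcongr
    linarith
  refine ⟨main _ (by positivity) ?_, fun hN => main _ (by positivity) ?_⟩
  · have h1 : 0 ≤ (N₁ : ℝ) / (N₂ : ℝ) ^ 2 + 1 / (N₂ * √(N₁ : ℝ))
        + 1 / (N₂ * √((N₁ : ℝ) * ((t + 1 : ℕ) : ℝ))) := by positivity
    linarith
  · rw [← hN, two_mul]
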